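/- Let $m\ge 0$ and let $\lambda=(\lambda_1\ge\dots\ge\lambda_\ell>0)$, $\ell=\ell(\lambda)$, be a partition of $m$. Let $V_\lambda$ be the irreducible complex representation of the symmetric group $\mathfrak S_m$ labelled by $\lambda$ (so that $V_{(m)}$ is trivial), and let $\chi^\lambda_\mu$ be its character at a permutation of cycle type $\mu\vdash m$. For $\mu=(1^{r_1}2^{r_2}\cdots m^{r_m})$ let $\ell(\mu)=r_1+\dots+r_m$ and let $g_\mu=\frac{m!}{1^{r_1}r_1!\cdots m^{r_m}r_m!}$ be the size of the conjugacy class of cycle type $\mu$. Then, as polynomials in $N$, $$f_\lambda(N):=\frac{1}{\dim V_\lambda}\sum_{\mu\vdash m}g_\mu\,\chi^\lambda_\mu\,N^{\ell(\mu)}=\prod_{(i,j)\in\lambda}(N-i+j),$$ where $(i,j)$ runs over the row and column indices of the boxes of the Young diagram of $\lambda$. Moreover $$f_\lambda(N)=\prod_{j=1}^{\ell(\lambda)}\frac{(N+\lambda_j-j)!}{(N-j)!}$$ for every integer $N\ge\ell(\lambda)$, and also for every complex number $N$ such that none of $N-1,\dots,N-\ell(\lambda)$ is a negative integer, with $z!=\Gamma(z+1)$.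 -/

import Mathlib

noncomputable section

namespace SymmetricGroupRep

/-- The parts of a partition in decreasing order, `λ₁ ≥ λ₂ ≥ ⋯ ≥ λ_ℓ > 0`. -/
def sortedParts {m : ℕ} (p : m.Partition) : List ℕ :=
  p.parts.sort (· ≥ ·)

theorem sortedParts_sortedGE {m : ℕ} (p : m.Partition) : (sortedParts p).SortedGE :=
  List.Pairwise.sortedGE (Multiset.pairwise_sort p.parts (· ≥ ·))

/-- The length `ℓ(λ)`, the number of (positive) parts. -/
def length {m : ℕ} (p : m.Partition) : ℕ := p.parts.card

/-- The `j`-th largest part `λ_j` (with `j` starting from `1`); it is `0` for `j > ℓ(λ)`. -/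
def part {m : ℕ} (p : m.Partition) (j : ℕ) : ℕ := (sortedParts p).getD (j - 1) 0

/-- The Young diagram of `λ`: the cells are the pairs `(i, j)` (row, column), both counted
from `0`, with `j` smaller than the length of row `i`. -/
def diagram {m : ℕ} (p : m.Partition) : YoungDiagram :=
  YoungDiagram.ofRowLens (sortedParts p) (sortedParts_sortedGE p)

theorem card_cellsOfRowLens (w : List ℕ) :
    (YoungDiagram.cellsOfRowLens w).card = w.sum := by
  induction w with
  | nil => rfl
  | cons a w ih =>
    rw [YoungDiagram.cellsOfRowLens, Finset.card_union_of_disjoint, Finset.card_map, ih]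
    · simp
    · rw [Finset.disjoint_left]
      rintro ⟨i, j⟩ h h'
      simp at h h'
      omega

theorem card_cells {m : ℕ} (p : m.Partition) : (diagram p).cells.card = m := by
  have h : (diagram p).cells.card = (sortedParts p).sum := card_cellsOfRowLens _
  rw [h, ← Multiset.sum_coe, sortedParts, Multiset.sort_eq, p.parts_sum]

/-- The cells of the Young diagram, listed in lexicographic order, that is, row by row. -/
def box {m : ℕ} (p : m.Partition) : Fin m ↪ ℕ ×ₗ ℕ :=
  (Finset.orderEmbOfFin ((diagram p).cells.map (toLex (α := ℕ × ℕ)).toEmbedding)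
    ((Finset.card_map _).trans (card_cells p))).toEmbedding

/-- The row of the letter `k` in the Young tableau of shape `λ` filled row by row. -/
def rowOf {m : ℕ} (p : m.Partition) (k : Fin m) : ℕ := (ofLex (box p k)).1

/-- The column of the letter `k` in the Young tableau of shape `λ` filled row by row. -/
def colOf {m : ℕ} (p : m.Partition) (k : Fin m) : ℕ := (ofLex (box p k)).2

/-- `a_λ`, the sum of all permutations that preserve the rows of the tableau. -/
def rowSymmetrizer {m : ℕ} (p : m.Partition) : MonoidAlgebra ℂ (Equiv.Perm (Fin m)) :=
  ∑ σ : Equiv.Perm (Fin m) with ∀ k, rowOf p (σ k) = rowOf p k,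
    MonoidAlgebra.of ℂ (Equiv.Perm (Fin m)) σ

/-- `b_λ`, the signed sum of all permutations that preserve the columns of the tableau. -/
def colAntisymmetrizer {m : ℕ} (p : m.Partition) : MonoidAlgebra ℂ (Equiv.Perm (Fin m)) :=
  ∑ σ : Equiv.Perm (Fin m) with ∀ k, colOf p (σ k) = colOf p k,
    ((Equiv.Perm.sign σ : ℤ) : ℂ) • MonoidAlgebra.of ℂ (Equiv.Perm (Fin m)) σ

/-- The Young symmetrizer `c_λ = a_λ b_λ`. -/
def youngSymmetrizer {m : ℕ} (p : m.Partition) : MonoidAlgebra ℂ (Equiv.Perm (Fin m)) :=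
  rowSymmetrizer p * colAntisymmetrizer p

/-- The irreducible module `V_λ = ℂ[𝔖_m] c_λ` of the symmetric group (the Specht module),
realised as the left ideal generated by the Young symmetrizer. -/
abbrev irrep {m : ℕ} (p : m.Partition) : Ideal (MonoidAlgebra ℂ (Equiv.Perm (Fin m))) :=
  Ideal.span {youngSymmetrizer p}

/-- The representation of `𝔖_m` on `V_λ` by left multiplication. -/
def irrepRep {m : ℕ} (p : m.Partition) :
    Representation ℂ (Equiv.Perm (Fin m)) (irrep p) :=
  Representation.ofModule' (irrep p)

/-- `dim V_λ`. -/
def dimIrrep {m : ℕ} (p : m.Partition) : ℕ := Module.finrank ℂ (irrep p)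

/-- Every partition of `m` is the cycle type (fixed points included) of a permutation of
`m` letters. -/
theorem exists_perm_cycleType {m : ℕ} (q : m.Partition) :
    ∃ σ : Equiv.Perm (Fin m), σ.partition.parts = q.parts := by
  have hle : (q.parts.filter (2 ≤ ·)).sum ≤ Fintype.card (Fin m) := by
    have h := congrArg Multiset.sum (Multiset.filter_add_not (2 ≤ ·) q.parts)
    rw [Multiset.sum_add] at h
    rw [Fintype.card_fin]
    have := q.parts_sum
    omega
  obtain ⟨σ, hσ⟩ := (Equiv.Perm.exists_with_cycleType_iff (Fin m)).2
    ⟨hle, fun a ha => (Multiset.mem_filter.1 ha).2⟩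
  refine ⟨σ, ?_⟩
  have key : ∀ s : Multiset ℕ, (∀ i ∈ s, 0 < i) →
      s = s.filter (2 ≤ ·) + Multiset.replicate (s.sum - (s.filter (2 ≤ ·)).sum) 1 := by
    intro s hs
    have h1 : s.filter (fun i => ¬ 2 ≤ i) =
        Multiset.replicate (s.filter (fun i => ¬ 2 ≤ i)).card 1 := by
      rw [Multiset.eq_replicate_card]
      intro b hb
      rw [Multiset.mem_filter] at hb
      have := hs b hb.1
      omega
    have h2 := Multiset.filter_add_not (2 ≤ ·) s
    have h3 : (s.filter (2 ≤ ·)).sum + (s.filter (fun i => ¬ 2 ≤ i)).sum = s.sum := by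
      rw [← Multiset.sum_add, h2]
    have h4 : (s.filter (fun i => ¬ 2 ≤ i)).sum = (s.filter (fun i => ¬ 2 ≤ i)).card := by
      conv_lhs => rw [h1]
      simp
    have h5 : s.sum - (s.filter (2 ≤ ·)).sum = (s.filter (fun i => ¬ 2 ≤ i)).card := by
      omega
    rw [h5, ← h1, h2]
  have := key q.parts (fun i hi => q.parts_pos hi)
  rw [Equiv.Perm.parts_partition, ← Equiv.Perm.sum_cycleType, hσ, Fintype.card_fin]
  conv_rhs => rw [this, q.parts_sum]

/-- `χ^λ_μ`: the character of `V_λ` at a permutation of cycle type `μ`. -/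
def character {m : ℕ} (p q : m.Partition) : ℂ :=
  (irrepRep p).character (exists_perm_cycleType q).choose

/-- The value `χ^λ_μ` does not depend on the permutation of cycle type `μ`. -/
theorem character_eq {m : ℕ} (p q : m.Partition) (σ : Equiv.Perm (Fin m))
    (h : σ.partition.parts = q.parts) : (irrepRep p).character σ = character p q := by
  have h' : σ.partition = (exists_perm_cycleType q).choose.partition :=
    Nat.Partition.ext (h.trans (exists_perm_cycleType q).choose_spec.symm)
  obtain ⟨g, hg⟩ := isConj_iff.1 (Equiv.Perm.partition_eq_of_isConj.2 h')
  rw [character, ← hg, Representation.char_conj]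

/-- `g_μ = m! / (1^{r₁} r₁! ⋯ m^{r_m} r_m!)`, where `r_i` is the number of parts of `μ`
equal to `i`. -/
def classCard {m : ℕ} (q : m.Partition) : ℚ :=
  (m.factorial : ℚ) /
    ∏ i ∈ Finset.Icc 1 m, ((i : ℚ) ^ q.parts.count i * ((q.parts.count i).factorial : ℚ))

/-- The polynomial `f_λ(N) = (1 / dim V_λ) ∑_{μ ⊢ m} g_μ χ^λ_μ N^{ℓ(μ)}`. -/
def samuelPoly {m : ℕ} (p : m.Partition) : Polynomial ℂ :=
  Polynomial.C (1 / (dimIrrep p : ℂ)) *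
    ∑ q : m.Partition,
      Polynomial.C ((classCard q : ℂ) * character p q) * Polynomial.X ^ length q

end SymmetricGroupRep

end

/-!
The element `Z = ∑ σ, z ^ cycleCount σ • σ` of the group algebra of `Perm (Fin m)` is central, and
`∑ σ, z ^ cycleCount σ * χ σ` is its trace on the left ideal `V` generated by the Young
symmetrizer `c`. It suffices to show that `Z - f` is nilpotent on `V`, where `f` is the product of
`z - i + j` over the cells `(i, j)`: then the trace is `f * dim V`, and `dim V ≠ 0` because the
coefficient of `1` in `c` is `1`. Since `Z` is central, nilpotency on `V` means `c * (Z - f) ^ k = 0`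
for some `k`. Neither the irreducibility of `V` nor Schur's lemma is used.

This is a statement about highest weight vectors. Permutations act on functions of words
`w : Fin m → ℕ` by permuting the positions, and this action commutes with the matrix units `E i j`
of `𝔤𝔩` acting on the letters. Let `v` be killed by all `E i j` with `i < j` and have weight `l`;
split `v` into components according to the first letter, and let `b` be the largest first letter
that occurs. Write `Z = (z + J) * Z'`, with `J` the Jucys-Murphy element of the first position and
`Z'` the analogue of `Z` for the other positions (`firstLetter_cycleOp`). The highest weight
condition forces `J` to act on the component at `b` by the scalar `l b - 1 - b`, the content of the
last cell of row `b` (`IsHighestWeight.firstLetter_cycleOp_of_top`), and this component is again a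
highest weight vector, of weight `l` with `l b` lowered by one. By induction on `m`, and on `b` for
the remaining components, `v` is a generalised eigenvector of `Z` whose eigenvalue is the content
product of `l` (`IsHighestWeight.exists_pow_apply_eq_zero`).

The polytabloid of the tableau of shape `λ` is such a vector of weight `λ`
(`isHighestWeight_polytabloid`): moving a letter to a higher row puts two letters of one column into
one row, and their transposition changes the sign of the column antisymmetrizer. Evaluation on the
rearrangements of the row word maps the polytabloid to `c` and turns the action of `Z` into right
multiplication by `Z`, which gives `c * (Z - f) ^ k = 0`.

The passage from cycle types to permutations is the formula for the sizes of conjugacy classes, and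
the quotients of Gamma values come from the product over the cells of a row.
-/

noncomputable section

namespace SymmetricGroupRep

open Equiv Equiv.Perm

/-! ### Cycle counts and class sizes -/

/-- The number of cycles of a permutation, fixed points included. -/
def cycleCount {m : ℕ} (σ : Perm (Fin m)) : ℕ := σ.partition.parts.card

theorem cycleCount_inv {m : ℕ} (σ : Perm (Fin m)) : cycleCount σ⁻¹ = cycleCount σ := by
  simp [cycleCount, parts_partition]

theorem cycleCount_conj {m : ℕ} (σ τ : Perm (Fin m)) :
    cycleCount (τ * σ * τ⁻¹) = cycleCount σ := by
  rw [cycleCount, cycleCount, ← partition_eq_of_isConj.1 (isConj_iff.2 ⟨τ, rfl⟩)]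

theorem cycleCount_eq_card_quotient {m : ℕ} (σ : Perm (Fin m)) :
    cycleCount σ = Nat.card (Quotient (SameCycle.setoid σ)) := by
  -- Each orbit is either a fixed point or the support of exactly one cycle factor; `a` picks a
  -- representative in each cycle.
  have hne : ∀ c : σ.cycleFactorsFinset, ∃ x, x ∈ (c : Perm (Fin m)).support := fun c =>
    (mem_cycleFactorsFinset_iff.1 c.2).1.nonempty_support
  choose a ha using hne
  have hcyc : ∀ c : σ.cycleFactorsFinset, σ.cycleOf (a c) = c := fun c =>
    (cycle_is_cycleOf (ha c) c.2).symm
  have hmov : ∀ c : σ.cycleFactorsFinset, σ (a c) ≠ a c := fun c => by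
    have := mem_cycleFactorsFinset_support_le c.2 (ha c)
    simpa using this
  let F : σ.cycleFactorsFinset ⊕ Function.fixedPoints σ → Quotient (SameCycle.setoid σ) :=
    Sum.elim (fun c => Quotient.mk (SameCycle.setoid σ) (a c))
      (fun x => Quotient.mk (SameCycle.setoid σ) (x : Fin m))
  have hF : Function.Bijective F := by
    constructor
    · rintro (c | x) (d | y) h
      · have h' : SameCycle σ (a c) (a d) := Quotient.exact h
        have := h'.cycleOf_eq
        rw [hcyc, hcyc] at this
        exact congrArg _ (Subtype.ext this)
      · have h' : SameCycle σ (a c) y := Quotient.exact h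
        exact absurd (h'.apply_eq_self_iff.2 y.2) (hmov c)
      · have h' : SameCycle σ x (a d) := Quotient.exact h
        exact absurd (h'.apply_eq_self_iff.1 x.2) (hmov d)
      · have h' : SameCycle σ (x : Fin m) y := Quotient.exact h
        exact congrArg _ (Subtype.ext (h'.eq_of_left x.2))
    · intro q
      induction q using Quotient.inductionOn with
      | _ x =>
        by_cases hx : σ x = x
        · exact ⟨Sum.inr ⟨x, hx⟩, rfl⟩
        · refine ⟨Sum.inl ⟨σ.cycleOf x, cycleOf_mem_cycleFactorsFinset_iff.2 (by simpa using hx)⟩, ?_⟩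
          refine Quotient.sound ?_
          have h1 := ha ⟨σ.cycleOf x,
            cycleOf_mem_cycleFactorsFinset_iff.2 (by simpa using hx)⟩
          exact ((mem_support_cycleOf_iff.1 h1).1).symm
  rw [← Nat.card_congr (Equiv.ofBijective F hF), Nat.card_sum, cycleCount, parts_partition,
    Multiset.card_add, Multiset.card_replicate, cycleType_def]
  congr 1
  · simp
  · rw [Nat.card_eq_fintype_card, card_fixedPoints, sum_cycleType]

/-- Functions constant on the cycles of `σ` are the functions on the set of cycles. -/
theorem card_invariant_bool {m : ℕ} (σ : Perm (Fin m)) :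
    Nat.card {φ : Fin m → Bool // ∀ x, φ (σ x) = φ x} = 2 ^ cycleCount σ := by
  have e : {φ : Fin m → Bool // ∀ x, φ (σ x) = φ x} ≃
      (Quotient (SameCycle.setoid σ) → Bool) :=
    { toFun := fun φ => Quotient.lift φ.1 (by
        rintro x y ⟨k, rfl⟩
        have : ∀ (k : ℕ) x, φ.1 ((σ ^ k) x) = φ.1 x := by
          intro k
          induction k with
          | zero => intro x; rfl
          | succ k ih => intro x; rw [pow_succ', Perm.mul_apply, φ.2, ih]
        cases k with
        | ofNat k => exact (this k x).symm
        | negSucc k =>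
          rw [zpow_negSucc]
          have h := this (k + 1) ((σ ^ (k + 1))⁻¹ x)
          rwa [← Perm.mul_apply, mul_inv_cancel, Perm.one_apply] at h)
      invFun := fun ψ => ⟨fun x => ψ (Quotient.mk _ x), fun x =>
        congrArg ψ (Quotient.sound (sameCycle_apply_left.2 (SameCycle.refl σ x)))⟩
      left_inv := fun φ => rfl
      right_inv := fun ψ => by
        funext q
        induction q using Quotient.inductionOn with
        | _ x => rfl }
  rw [Nat.card_congr e, Nat.card_fun, cycleCount_eq_card_quotient]
  simp

/-- The permutation fixing `0` and acting as `e` elsewhere has one more cycle than `e`. -/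
theorem cycleCount_decomposeFin_zero {m : ℕ} (e : Perm (Fin m)) :
    cycleCount (decomposeFin.symm (0, e)) = cycleCount e + 1 := by
  apply Nat.pow_right_injective le_rfl
  change 2 ^ _ = 2 ^ _
  rw [← card_invariant_bool, pow_succ, ← card_invariant_bool,
    show (2 : ℕ) = Nat.card Bool by simp, ← Nat.card_prod]
  refine Nat.card_congr
    { toFun := fun φ => (⟨fun x => φ.1 x.succ, fun x => ?_⟩, φ.1 0)
      invFun := fun ψ => ⟨Fin.cons ψ.2 ψ.1.1, fun x => ?_⟩
      left_inv := fun φ => ?_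
      right_inv := fun ψ => ?_ }
  · simpa using φ.2 x.succ
  · refine Fin.cases ?_ (fun x => ?_) x
    · simp
    · simpa using ψ.1.2 x
  · ext x
    refine Fin.cases ?_ (fun x => ?_) x <;> simp
  · simp

/-- Multiplying by a transposition `(0 i)` inserts `0` into the cycle of `i`: an invariant function
is determined by its values away from `0`, which are invariant under `e`. -/
theorem cycleCount_decomposeFin_succ {m : ℕ} (i : Fin m) (e : Perm (Fin m)) :
    cycleCount (decomposeFin.symm (i.succ, e)) = cycleCount e := by
  have hswap : ∀ φ : Fin (m + 1) → Bool, φ i.succ = φ 0 →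
      ∀ y, φ (swap 0 i.succ y) = φ y := by
    intro φ h y
    rw [swap_apply_def]
    split_ifs with h1 h2
    · rw [h1, h]
    · rw [h2, h]
    · rfl
  apply Nat.pow_right_injective le_rfl
  change 2 ^ _ = 2 ^ _
  rw [← card_invariant_bool, ← card_invariant_bool]
  have h0 : ∀ φ : {φ : Fin (m + 1) → Bool //
      ∀ x, φ (decomposeFin.symm (i.succ, e) x) = φ x}, φ.1 i.succ = φ.1 0 := fun φ => by
    simpa using φ.2 0
  refine Nat.card_congr
    { toFun := fun φ => ⟨fun x => φ.1 x.succ, fun x => ?_⟩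
      invFun := fun ψ => ⟨Fin.cons (ψ.1 i) ψ.1, fun x => ?_⟩
      left_inv := fun φ => ?_
      right_inv := fun ψ => ?_ }
  · have := φ.2 x.succ
    rwa [decomposeFin_symm_apply_succ, hswap _ (h0 φ)] at this
  · refine Fin.cases ?_ (fun x => ?_) x
    · simp
    · rw [decomposeFin_symm_apply_succ,
        hswap (Fin.cons (ψ.1 i) ψ.1) (by rw [Fin.cons_succ, Fin.cons_zero])]
      simpa using ψ.2 x
  · ext x
    refine Fin.cases ?_ (fun x => ?_) x
    · simp [h0 φ]
    · simp
  · simp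

/-- The size of a conjugacy class of the symmetric group. -/
theorem classCard_eq_card {m : ℕ} (q : m.Partition) :
    classCard q = (Finset.univ.filter fun σ : Perm (Fin m) => σ.partition.parts = q.parts).card := by
  obtain ⟨τ, hτ⟩ := exists_perm_cycleType q
  have hsum := τ.sum_cycleType_le
  have hcard := card_of_cycleType_mul_eq (Fin m) τ.cycleType
  rw [if_pos ⟨hsum, fun a ha => two_le_of_mem_cycleType ha⟩, Fintype.card_fin] at hcard
  have hset : (Finset.univ.filter fun σ : Perm (Fin m) => σ.partition.parts = q.parts) =
      Finset.univ.filter fun σ : Perm (Fin m) => σ.cycleType = τ.cycleType := by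
    ext σ
    rw [Finset.mem_filter, Finset.mem_filter, ← hτ]
    refine and_congr_right fun _ => ⟨fun h => ?_, fun h => ?_⟩
    · rw [← filter_parts_partition_eq_cycleType, h, filter_parts_partition_eq_cycleType]
    · rw [parts_partition, parts_partition, ← sum_cycleType, ← sum_cycleType, h]
  have hparts : q.parts = τ.cycleType + Multiset.replicate (m - τ.cycleType.sum) 1 := by
    rw [← hτ, parts_partition, sum_cycleType, Fintype.card_fin]
  have hone : τ.cycleType.count 1 = 0 :=
    Multiset.count_eq_zero.2 fun h => absurd (two_le_of_mem_cycleType h) (by norm_num)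
  have hsub : q.parts.toFinset ⊆ Finset.Icc 1 m := fun i hi => by
    rw [Multiset.mem_toFinset] at hi
    exact Finset.mem_Icc.2 ⟨q.parts_pos hi, q.le_of_mem_parts hi⟩
  have hprod : ∏ i ∈ Finset.Icc 1 m, i ^ q.parts.count i = τ.cycleType.prod := by
    rw [← Finset.prod_multiset_count_of_subset _ _ hsub, hparts]
    simp
  have hfact : ∏ i ∈ Finset.Icc 1 m, (q.parts.count i).factorial =
      (m - τ.cycleType.sum).factorial *
        ∏ i ∈ τ.cycleType.toFinset, (τ.cycleType.count i).factorial := by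
    -- For `m = 0` the letter `1` is not in `Icc 1 m`, so it is adjoined first.
    have h1 : ∏ i ∈ Finset.Icc 1 m, (q.parts.count i).factorial =
        ∏ i ∈ insert 1 (Finset.Icc 1 m), (q.parts.count i).factorial := by
      refine Finset.prod_subset (Finset.subset_insert _ _) fun i _ hi => ?_
      rw [Multiset.count_eq_zero.2 fun h => hi (hsub (Multiset.mem_toFinset.2 h)),
        Nat.factorial_zero]
    rw [h1, ← Finset.mul_prod_erase _ _ (Finset.mem_insert_self 1 _)]
    congr 1
    · rw [hparts, Multiset.count_add, hone, Multiset.count_replicate_self, zero_add]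
    · have h2 : ∀ i ∈ (insert 1 (Finset.Icc 1 m)).erase 1,
          (q.parts.count i).factorial = (τ.cycleType.count i).factorial := fun i hi => by
        rw [hparts, Multiset.count_add, Multiset.count_replicate,
          if_neg (Finset.ne_of_mem_erase hi).symm, add_zero]
      rw [Finset.prod_congr rfl h2]
      symm
      refine Finset.prod_subset (fun i hi => ?_) fun i _ hi => ?_
      · rw [Multiset.mem_toFinset] at hi
        refine Finset.mem_erase.2 ⟨?_, Finset.mem_insert_of_mem (hsub ?_)⟩
        · have := two_le_of_mem_cycleType hi
          omega
        · rw [Multiset.mem_toFinset, hparts]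
          exact Multiset.mem_add.2 (Or.inl hi)
      · rw [Multiset.count_eq_zero.2 fun h => hi (Multiset.mem_toFinset.2 h),
          Nat.factorial_zero]
  have hpos : (0 : ℚ) < ∏ i ∈ Finset.Icc 1 m,
      ((i : ℚ) ^ q.parts.count i * ((q.parts.count i).factorial : ℚ)) := by
    refine Finset.prod_pos fun i hi => ?_
    have : 0 < i := (Finset.mem_Icc.1 hi).1
    positivity
  rw [classCard, div_eq_iff hpos.ne', hset, ← hcard, Finset.prod_mul_distrib]
  have hprod' := congrArg (Nat.cast : ℕ → ℚ) hprod
  have hfact' := congrArg (Nat.cast : ℕ → ℚ) hfact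
  push_cast at hprod' hfact' ⊢
  rw [hprod', hfact']
  ring

/-- A sum over cycle types, weighted by class sizes, is a sum over permutations. -/
theorem sum_classCard_mul_character {m : ℕ} (p : m.Partition) (z : ℂ) :
    ∑ q : m.Partition, (classCard q : ℂ) * character p q * z ^ length q =
      ∑ σ : Perm (Fin m), z ^ cycleCount σ * (irrepRep p).character σ := by
  classical
  let P : Perm (Fin m) → m.Partition := fun σ =>
    ⟨σ.partition.parts, σ.partition.parts_pos, by
      rw [σ.partition.parts_sum, Fintype.card_fin]⟩
  rw [← Finset.sum_fiberwise Finset.univ P]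
  refine Finset.sum_congr rfl fun q _ => ?_
  have hP : ∀ σ, P σ = q ↔ σ.partition.parts = q.parts := fun σ => by
    rw [Nat.Partition.ext_iff]
  rw [classCard_eq_card, Finset.filter_congr fun σ _ => hP σ,
    Finset.sum_congr rfl (g := fun _ => character p q * z ^ length q), Finset.sum_const,
    nsmul_eq_mul]
  · push_cast
    ring
  · intro σ hσ
    have hσ' := (Finset.mem_filter.1 hσ).2
    rw [character_eq p q σ hσ', cycleCount, hσ', length, mul_comm]

/-! ### Permutations of positions and matrix units on letters -/

/-- `∑ σ, z ^ cycleCount σ • σ` acting on functions of words `w : Fin m → ℕ` by permuting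
the positions of the letters. -/
def cycleOp (z : ℂ) (m : ℕ) : Module.End ℂ ((Fin m → ℕ) → ℂ) where
  toFun v w := ∑ σ : Perm (Fin m), z ^ cycleCount σ * v (w ∘ σ)
  map_add' u v := by
    ext w
    simp [mul_add, Finset.sum_add_distrib]
  map_smul' c v := by
    ext w
    simp [Finset.mul_sum, mul_left_comm]

theorem cycleOp_apply (z : ℂ) {m : ℕ} (v : (Fin m → ℕ) → ℂ) (w : Fin m → ℕ) :
    cycleOp z m v w = ∑ σ : Perm (Fin m), z ^ cycleCount σ * v (w ∘ σ) := rfl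

/-- The matrix unit `E i j` of `𝔤𝔩` acting on functions of words: on the basis of words it
replaces, in all possible ways, one letter `j` by the letter `i`. -/
def letterOp (i j : ℕ) (m : ℕ) : Module.End ℂ ((Fin m → ℕ) → ℂ) where
  toFun v w := ∑ p : Fin m, if w p = i then v (Function.update w p j) else 0
  map_add' u v := by
    ext w
    simp only [Pi.add_apply, ← Finset.sum_add_distrib]
    refine Finset.sum_congr rfl fun p _ => ?_
    split_ifs <;> simp
  map_smul' c v := by
    ext w
    simp [Finset.mul_sum]

theorem letterOp_apply (i j : ℕ) {m : ℕ} (v : (Fin m → ℕ) → ℂ) (w : Fin m → ℕ) :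
    letterOp i j m v w = ∑ p : Fin m, if w p = i then v (Function.update w p j) else 0 := rfl

/-- Permuting positions commutes with the action of `𝔤𝔩` on letters. -/
theorem letterOp_comp_perm (i j : ℕ) {m : ℕ} (v : (Fin m → ℕ) → ℂ) (w : Fin m → ℕ)
    (σ : Perm (Fin m)) :
    letterOp i j m (fun u => v (u ∘ σ)) w = letterOp i j m v (w ∘ σ) := by
  rw [letterOp_apply, letterOp_apply, ← Equiv.sum_comp σ]
  refine Finset.sum_congr rfl fun p _ => ?_
  rw [Function.update_comp_equiv, Equiv.symm_apply_apply]
  rfl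

theorem letterOp_cycleOp (i j : ℕ) (z : ℂ) {m : ℕ} (v : (Fin m → ℕ) → ℂ) :
    letterOp i j m (cycleOp z m v) = cycleOp z m (letterOp i j m v) := by
  have h : cycleOp z m v = ∑ σ : Perm (Fin m), z ^ cycleCount σ • fun u => v (u ∘ σ) := by
    ext w
    simp [cycleOp_apply]
  ext w
  rw [h, map_sum, Finset.sum_apply, cycleOp_apply]
  refine Finset.sum_congr rfl fun σ _ => ?_
  rw [map_smul, Pi.smul_apply, letterOp_comp_perm, smul_eq_mul]

/-- The component of `v` on the words whose first letter is `b`. -/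
def firstLetter (b : ℕ) (m : ℕ) : ((Fin (m + 1) → ℕ) → ℂ) →ₗ[ℂ] ((Fin m → ℕ) → ℂ) where
  toFun v w := v (Fin.cons b w : Fin (m + 1) → ℕ)
  map_add' _ _ := rfl
  map_smul' _ _ := rfl

theorem firstLetter_apply (b : ℕ) {m : ℕ} (v : (Fin (m + 1) → ℕ) → ℂ) (w : Fin m → ℕ) :
    firstLetter b m v w = v (Fin.cons b w : Fin (m + 1) → ℕ) := rfl

theorem cons_comp_decomposeFin_zero {m : ℕ} (b : ℕ) (w : Fin m → ℕ) (e : Perm (Fin m)) :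
    (Fin.cons b w : Fin (m + 1) → ℕ) ∘ decomposeFin.symm (0, e) =
      (Fin.cons b (w ∘ e) : Fin (m + 1) → ℕ) := by
  funext x
  refine Fin.cases ?_ (fun x => ?_) x <;> simp

theorem cons_comp_decomposeFin_succ {m : ℕ} (b : ℕ) (w : Fin m → ℕ) (i : Fin m)
    (e : Perm (Fin m)) :
    (Fin.cons b w : Fin (m + 1) → ℕ) ∘ decomposeFin.symm (i.succ, e) =
      (Fin.cons (w i) (Function.update w i b ∘ e) : Fin (m + 1) → ℕ) := by
  funext x
  refine Fin.cases ?_ (fun x => ?_) x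
  · simp
  · simp only [Function.comp_apply, decomposeFin_symm_apply_succ, Fin.cons_succ]
    by_cases h : e x = i
    · rw [h, swap_apply_right, Fin.cons_zero, Function.update_self]
    · rw [swap_apply_of_ne_of_ne (Fin.succ_ne_zero _) (fun h' => h (Fin.succ_injective _ h')),
        Function.update_of_ne h, Fin.cons_succ]

/-- The factorisation `∑ σ, z ^ cycleCount σ • σ = (z + J) * ∑ τ, z ^ cycleCount τ • τ`, where
`τ` fixes the first position and `J` is the Jucys-Murphy element, the sum of the transpositions
that move the first position. -/
theorem firstLetter_cycleOp (b : ℕ) (z : ℂ) {m : ℕ} (v : (Fin (m + 1) → ℕ) → ℂ)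
    (w : Fin m → ℕ) :
    firstLetter b m (cycleOp z (m + 1) v) w =
      z * cycleOp z m (firstLetter b m v) w +
        ∑ i : Fin m, cycleOp z m (firstLetter (w i) m v) (Function.update w i b) := by
  rw [firstLetter_apply, cycleOp_apply, ← Equiv.sum_comp decomposeFin.symm,
    Fintype.sum_prod_type, Fin.sum_univ_succ]
  congr 1
  · rw [cycleOp_apply, Finset.mul_sum]
    refine Finset.sum_congr rfl fun e _ => ?_
    rw [cons_comp_decomposeFin_zero, cycleCount_decomposeFin_zero, firstLetter_apply]
    ring
  · refine Finset.sum_congr rfl fun i _ => ?_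
    rw [cycleOp_apply]
    refine Finset.sum_congr rfl fun e _ => ?_
    rw [cons_comp_decomposeFin_succ, cycleCount_decomposeFin_succ, firstLetter_apply]

theorem firstLetter_letterOp (a i j : ℕ) {m : ℕ} (v : (Fin (m + 1) → ℕ) → ℂ) :
    firstLetter a m (letterOp i j (m + 1) v) =
      (if a = i then firstLetter j m v else 0) + letterOp i j m (firstLetter a m v) := by
  ext w
  rw [firstLetter_apply, letterOp_apply, Fin.sum_univ_succ, Pi.add_apply]
  congr 1
  · rw [Fin.cons_zero, Fin.update_cons_zero]
    split_ifs <;> rfl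
  · rw [letterOp_apply]
    refine Finset.sum_congr rfl fun p _ => ?_
    rw [Fin.cons_succ, ← Fin.cons_update, firstLetter_apply]

/-! ### Highest weight vectors -/

/-- `v` is a highest weight vector of weight `l`: it is supported on the words in which each
letter `i` occurs `l i` times, and it is killed by the matrix units `E i j` with `i < j`. -/
structure IsHighestWeight {m : ℕ} (l : ℕ → ℕ) (v : (Fin m → ℕ) → ℂ) : Prop where
  weight : ∀ w, v w ≠ 0 → ∀ i, (Finset.univ.filter fun p => w p = i).card = l i
  raise : ∀ i j, i < j → letterOp i j m v = 0

namespace IsHighestWeight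

variable {m : ℕ} {l : ℕ → ℕ}

theorem cycleOp {v : (Fin m → ℕ) → ℂ} (hv : IsHighestWeight l v) (z : ℂ) :
    IsHighestWeight l (cycleOp z m v) where
  weight w hw i := by
    rw [cycleOp_apply] at hw
    obtain ⟨σ, -, hσ⟩ := Finset.exists_ne_zero_of_sum_ne_zero hw
    rw [← hv.weight _ (right_ne_zero_of_mul hσ) i]
    refine (Finset.card_bij (fun p _ => σ p) ?_ ?_ ?_).symm
    · intro p hp
      simpa using hp
    · intro p _ q _ h
      exact σ.injective h
    · intro p hp
      exact ⟨σ.symm p, by simpa using hp, by simp⟩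
  raise i j h := by rw [letterOp_cycleOp, hv.raise i j h, map_zero]

theorem sub_smul {u v : (Fin m → ℕ) → ℂ} (hu : IsHighestWeight l u) (hv : IsHighestWeight l v)
    (c : ℂ) : IsHighestWeight l (u - c • v) where
  weight w hw i := by
    by_cases h : u w = 0
    · refine hv.weight w (fun h' => hw ?_) i
      simp [h, h']
    · exact hu.weight w h i
  raise i j h := by rw [map_sub, map_smul, hu.raise i j h, hv.raise i j h, smul_zero, sub_zero]

variable {v : (Fin (m + 1) → ℕ) → ℂ} (hv : IsHighestWeight l v)
include hv

theorem letterOp_firstLetter {i j : ℕ} (h : i < j) :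
    letterOp i j m (firstLetter i m v) = -firstLetter j m v := by
  have := firstLetter_letterOp i i j v
  rw [hv.raise i j h, map_zero, if_pos rfl] at this
  exact (neg_eq_of_add_eq_zero_right this.symm).symm

theorem card_firstLetter {b : ℕ} {w : Fin m → ℕ} (hw : firstLetter b m v w ≠ 0) (i : ℕ) :
    (if b = i then 1 else 0) + (Finset.univ.filter fun p => w p = i).card = l i := by
  rw [← hv.weight _ hw i, Fin.card_filter_univ_succ, Fin.cons_zero]
  simp only [Fin.cons_succ]
  split_ifs <;> omega

theorem pos_of_firstLetter_ne_zero {b : ℕ} (h : firstLetter b m v ≠ 0) : 0 < l b := by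
  obtain ⟨w, hw⟩ := Function.ne_iff.1 h
  have := hv.card_firstLetter hw b
  rw [if_pos rfl] at this
  omega

/-- The component at the largest first letter is again a highest weight vector. -/
theorem firstLetter {b : ℕ} (htop : ∀ a, b < a → firstLetter a m v = 0) :
    IsHighestWeight (Function.update l b (l b - 1)) (firstLetter b m v) where
  weight w hw i := by
    have := hv.card_firstLetter hw i
    by_cases h : b = i
    · subst h
      rw [if_pos rfl] at this
      rw [Function.update_self]
      omega
    · rw [if_neg h] at this
      rw [Function.update_of_ne (Ne.symm h)]
      omega
  raise i j h := by
    have := firstLetter_letterOp b i j v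
    rw [hv.raise i j h, map_zero] at this
    split_ifs at this with hb
    · rw [htop j (hb ▸ h), zero_add] at this
      exact this.symm
    · rw [zero_add] at this
      exact this.symm

/-- On the component at the largest first letter `b` the Jucys-Murphy element acts by the scalar
`l b - 1 - b`: each of the `b` letters below `b` contributes `-1` by the highest weight
condition, and `b` itself contributes the number of its remaining occurrences. -/
theorem firstLetter_cycleOp_of_top {b : ℕ} (z : ℂ)
    (htop : ∀ a, b < a → SymmetricGroupRep.firstLetter a m v = 0) :
    SymmetricGroupRep.firstLetter b m (SymmetricGroupRep.cycleOp z (m + 1) v) =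
      (z - b + ((l b - 1 : ℕ) : ℂ)) •
        SymmetricGroupRep.cycleOp z m (SymmetricGroupRep.firstLetter b m v) := by
  ext w
  set u : ℕ → (Fin m → ℕ) → ℂ :=
    fun a => SymmetricGroupRep.cycleOp z m (SymmetricGroupRep.firstLetter a m v) with hu
  have hsplit : ∀ i : Fin m, u (w i) (Function.update w i b) =
      ∑ a ∈ Finset.range (b + 1), if w i = a then u a (Function.update w i b) else 0 := by
    intro i
    rw [Finset.sum_ite_eq]
    split_ifs with h
    · rfl
    · rw [Finset.mem_range, not_lt, Nat.succ_le_iff] at h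
      simp [hu, htop _ h]
  have hlow : ∀ a ∈ Finset.range b, letterOp a b m (u a) w = -u b w := fun a ha => by
    rw [hu, letterOp_cycleOp, hv.letterOp_firstLetter (Finset.mem_range.1 ha), map_neg]
    rfl
  have hdiag : letterOp b b m (u b) w = ((l b - 1 : ℕ) : ℂ) * u b w := by
    by_cases h0 : u b w = 0
    · rw [h0, mul_zero, letterOp_apply]
      refine Finset.sum_eq_zero fun p _ => ?_
      split_ifs with h
      · rw [← h, Function.update_eq_self, h, h0]
      · rfl
    · have hc := ((hv.firstLetter htop).cycleOp z).weight w h0 b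
      rw [Function.update_self] at hc
      rw [← hc, letterOp_apply, Finset.card_filter, Nat.cast_sum, Finset.sum_mul]
      refine Finset.sum_congr rfl fun p _ => ?_
      split_ifs with h
      · rw [← h, Function.update_eq_self, Nat.cast_one, one_mul]
      · simp
  rw [firstLetter_cycleOp, Finset.sum_congr rfl fun i _ => hsplit i, Finset.sum_comm,
    Finset.sum_range_succ]
  change z * u b w + ((∑ a ∈ Finset.range b, letterOp a b m (u a) w) +
    letterOp b b m (u b) w) = (z - b + ((l b - 1 : ℕ) : ℂ)) * u b w
  rw [Finset.sum_congr rfl hlow, hdiag, Finset.sum_const, Finset.card_range, nsmul_eq_mul]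
  ring

end IsHighestWeight

/-! ### The generalised eigenvalue of a highest weight vector -/

/-- The product of `z - i + j` over the cells `(i, j)`, `j < l i`, of the first `n` rows. -/
def contentProd (n : ℕ) (l : ℕ → ℕ) (z : ℂ) : ℂ :=
  ∏ i ∈ Finset.range n, ∏ j ∈ Finset.range (l i), (z - i + j)

theorem contentProd_update {n : ℕ} {l : ℕ → ℕ} {b : ℕ} (hb : b < n) (hl : 0 < l b) (z : ℂ) :
    contentProd n l z = (z - b + ((l b - 1 : ℕ) : ℂ)) *
      contentProd n (Function.update l b (l b - 1)) z := by
  have hb' := Finset.mem_range.2 hb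
  rw [contentProd, contentProd, ← Finset.mul_prod_erase _ _ hb',
    ← Finset.mul_prod_erase (Finset.range n)
      (fun i => ∏ j ∈ Finset.range (Function.update l b (l b - 1) i), (z - i + j)) hb',
    Function.update_self, ← mul_assoc]
  congr 1
  · obtain ⟨k, hk⟩ := Nat.exists_eq_succ_of_ne_zero hl.ne'
    rw [hk, Finset.prod_range_succ, Nat.succ_sub_one, mul_comm]
  · refine Finset.prod_congr rfl fun i hi => ?_
    rw [Function.update_of_ne (Finset.ne_of_mem_erase hi)]

/-- A highest weight vector is a generalised eigenvector of `∑ σ, z ^ cycleCount σ • σ`, with the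
content product of its weight as eigenvalue. -/
theorem IsHighestWeight.exists_pow_apply_eq_zero {n : ℕ} (z : ℂ) {m : ℕ} {l : ℕ → ℕ}
    (hl : ∀ i, n ≤ i → l i = 0) {v : (Fin m → ℕ) → ℂ} (hv : IsHighestWeight l v) :
    ∃ k : ℕ, ((SymmetricGroupRep.cycleOp z m - algebraMap ℂ _ (contentProd n l z)) ^ k) v = 0 := by
  induction m generalizing l with
  | zero =>
    by_cases h : v = 0
    · exact ⟨0, by simp [h]⟩
    · obtain ⟨w, hw⟩ := Function.ne_iff.1 h
      have hl0 : ∀ i, l i = 0 := fun i => by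
        rw [← hv.weight w hw i]
        simp
      refine ⟨1, ?_⟩
      ext u
      have hc : cycleCount (1 : Perm (Fin 0)) = 0 := by
        simp [cycleCount, parts_partition]
      rw [pow_one, LinearMap.sub_apply, Pi.sub_apply, cycleOp_apply,
        Fintype.sum_subsingleton _ (1 : Perm (Fin 0)), hc]
      simp [contentProd, hl0]
  | succ m ih =>
    suffices H : ∀ (B : ℕ) (v : (Fin (m + 1) → ℕ) → ℂ), IsHighestWeight l v →
        (∀ a, B ≤ a → SymmetricGroupRep.firstLetter a m v = 0) →
        ∃ k : ℕ, ((SymmetricGroupRep.cycleOp z (m + 1) -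
          algebraMap ℂ _ (contentProd n l z)) ^ k) v = 0 by
      refine H n v hv fun a ha => ?_
      by_contra h
      exact (hv.pos_of_firstLetter_ne_zero h).ne' (hl a ha)
    intro B
    induction B with
    | zero =>
      intro v _ htop
      refine ⟨0, ?_⟩
      ext w
      have := congrFun (htop (w 0) (Nat.zero_le _)) (Fin.tail w)
      rw [firstLetter_apply, Fin.cons_self_tail] at this
      simpa using this
    | succ b ihB =>
      intro v hv htop
      by_cases hb : SymmetricGroupRep.firstLetter b m v = 0
      · refine ihB v hv fun a ha => ?_
        rcases ha.eq_or_lt with rfl | h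
        · exact hb
        · exact htop a h
      have hlb := hv.pos_of_firstLetter_ne_zero hb
      have hbn : b < n := by
        by_contra h
        exact hlb.ne' (hl b (not_lt.1 h))
      set D := SymmetricGroupRep.cycleOp z (m + 1) - algebraMap ℂ _ (contentProd n l z) with hD
      set l' := Function.update l b (l b - 1) with hl'
      set c : ℂ := z - b + ((l b - 1 : ℕ) : ℂ) with hc
      obtain ⟨k, hk⟩ := ih (l := l') (fun i hi => by
        rw [hl', Function.update_of_ne (by omega), hl i hi]) (hv.firstLetter htop)
      have hDv : ∀ u, D u = SymmetricGroupRep.cycleOp z (m + 1) u - contentProd n l z • u :=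
        fun u => by rw [hD, LinearMap.sub_apply, Module.algebraMap_end_apply]
      -- `D ^ k` preserves highest weight vectors with largest first letter at most `b`, and
      -- acts on their component at `b` through the operator of the smaller weight `l'`.
      have key : ∀ k : ℕ, IsHighestWeight l ((D ^ k) v) ∧
          (∀ a, b + 1 ≤ a → SymmetricGroupRep.firstLetter a m ((D ^ k) v) = 0) ∧
          SymmetricGroupRep.firstLetter b m ((D ^ k) v) = c ^ k •
            ((SymmetricGroupRep.cycleOp z m - algebraMap ℂ _ (contentProd n l' z)) ^ k)
              (SymmetricGroupRep.firstLetter b m v) := by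
        intro k
        induction k with
        | zero => exact ⟨by simpa using hv, by simpa using htop, by simp⟩
        | succ k ihk =>
          obtain ⟨h1, h2, h3⟩ := ihk
          rw [pow_succ' D, Module.End.mul_apply, hDv]
          refine ⟨(h1.cycleOp z).sub_smul h1 _, fun a ha => ?_, ?_⟩
          · rw [map_sub, map_smul, h2 a ha, smul_zero, sub_zero,
              h1.firstLetter_cycleOp_of_top z fun a' ha' => h2 a' (by omega), h2 a ha,
              map_zero, smul_zero]
          · rw [map_sub, map_smul, h1.firstLetter_cycleOp_of_top z h2, ← hc, h3,
              contentProd_update hbn hlb, ← hl', ← hc, pow_succ' (_ - _), Module.End.mul_apply,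
              LinearMap.sub_apply, Module.algebraMap_end_apply, map_smul]
            module
      obtain ⟨h1, h2, h3⟩ := key k
      rw [hk, smul_zero] at h3
      obtain ⟨k', hk'⟩ := ihB ((D ^ k) v) h1 fun a ha => by
        rcases ha.eq_or_lt with rfl | h
        · exact h3
        · exact h2 a h
      exact ⟨k' + k, by rw [pow_add, Module.End.mul_apply, hk']⟩

/-! ### Cells of the diagram -/

section Diagram

variable {m : ℕ} (p : m.Partition)

theorem box_mem (k : Fin m) : (rowOf p k, colOf p k) ∈ (diagram p).cells := by
  have h := Finset.orderEmbOfFin_mem ((diagram p).cells.map (toLex (α := ℕ × ℕ)).toEmbedding)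
    ((Finset.card_map _).trans (card_cells p)) k
  obtain ⟨c, hc, hck⟩ := Finset.mem_map.1 h
  have : c = (rowOf p k, colOf p k) := by
    rw [rowOf, colOf, box]
    exact congrArg ofLex hck
  exact this ▸ hc

theorem exists_box_eq {c : ℕ × ℕ} (hc : c ∈ (diagram p).cells) :
    ∃ k, rowOf p k = c.1 ∧ colOf p k = c.2 := by
  have h := Finset.range_orderEmbOfFin
    ((diagram p).cells.map (toLex (α := ℕ × ℕ)).toEmbedding)
    ((Finset.card_map _).trans (card_cells p))
  have hc' : toLex c ∈ Set.range (Finset.orderEmbOfFin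
      ((diagram p).cells.map (toLex (α := ℕ × ℕ)).toEmbedding)
      ((Finset.card_map _).trans (card_cells p))) := by
    rw [h]
    exact Finset.mem_coe.2 (Finset.mem_map_of_mem _ hc)
  obtain ⟨k, hk⟩ := hc'
  refine ⟨k, ?_, ?_⟩
  · exact congrArg (fun x => (ofLex x).1) hk
  · exact congrArg (fun x => (ofLex x).2) hk

theorem box_ext {k k' : Fin m} (hr : rowOf p k = rowOf p k') (hc : colOf p k = colOf p k') :
    k = k' :=
  (box p).injective (ofLex.injective (Prod.ext hr hc))

theorem rowLen_diagram (i : ℕ) : (diagram p).rowLen i = part p (i + 1) := by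
  rw [part, Nat.add_sub_cancel]
  refine eq_of_forall_lt_iff fun j => ?_
  rw [← YoungDiagram.mem_iff_lt_rowLen, diagram, YoungDiagram.mem_ofRowLens]
  by_cases h : i < (sortedParts p).length
  · rw [List.getD_eq_getElem _ _ h]
    exact ⟨fun ⟨_, h'⟩ => h', fun h' => ⟨h, h'⟩⟩
  · rw [List.getD_eq_default _ _ (not_lt.1 h)]
    exact ⟨fun ⟨h', _⟩ => absurd h' h, fun h' => absurd h' (Nat.not_lt_zero _)⟩

theorem card_rowOf_eq (i : ℕ) :
    (Finset.univ.filter fun k => rowOf p k = i).card = part p (i + 1) := by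
  rw [← rowLen_diagram, YoungDiagram.rowLen_eq_card]
  refine Finset.card_bij (fun k _ => (rowOf p k, colOf p k)) ?_ ?_ ?_
  · intro k hk
    exact YoungDiagram.mem_row_iff.2 ⟨box_mem p k, (Finset.mem_filter.1 hk).2⟩
  · intro k _ k' _ h
    exact box_ext p (congrArg Prod.fst h) (congrArg Prod.snd h)
  · intro c hc
    obtain ⟨hc1, hc2⟩ := YoungDiagram.mem_row_iff.1 hc
    obtain ⟨k, hk1, hk2⟩ := exists_box_eq p hc1
    exact ⟨k, Finset.mem_filter.2 ⟨Finset.mem_univ _, hk1.trans hc2⟩, Prod.ext hk1 hk2⟩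

theorem part_eq_zero {i : ℕ} (hi : length p ≤ i) : part p (i + 1) = 0 := by
  rw [part, List.getD_eq_default]
  rw [sortedParts, Multiset.length_sort]
  exact hi

theorem prod_cells_eq_contentProd (z : ℂ) :
    ∏ c ∈ (diagram p).cells, (z - (c.1 : ℂ) + (c.2 : ℂ)) =
      contentProd (length p) (fun i => part p (i + 1)) z := by
  rw [contentProd, Finset.prod_sigma']
  refine Finset.prod_bij' (fun c _ => ⟨c.1, c.2⟩) (fun c _ => (c.1, c.2)) ?_ ?_ ?_ ?_ ?_
  · intro c hc
    have h := YoungDiagram.mem_iff_lt_rowLen.1 ((YoungDiagram.mem_cells _).1 hc)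
    rw [rowLen_diagram] at h
    refine Finset.mem_sigma.2 ⟨Finset.mem_range.2 ?_, Finset.mem_range.2 h⟩
    by_contra h'
    rw [part_eq_zero p (not_lt.1 h')] at h
    exact absurd h (Nat.not_lt_zero _)
  · intro c hc
    have h := Finset.mem_range.1 (Finset.mem_sigma.1 hc).2
    rw [← rowLen_diagram] at h
    exact (YoungDiagram.mem_cells _).2 (YoungDiagram.mem_iff_lt_rowLen.2 h)
  · intro c _
    rfl
  · intro c _
    rfl
  · intro c _
    rfl

end Diagram

/-! ### The Young symmetrizer and the trace -/

section GroupAlgebra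

variable {m : ℕ}

/-- The element `∑ σ, z ^ cycleCount σ • σ` of the group algebra. -/
def cycleSum (z : ℂ) (m : ℕ) : MonoidAlgebra ℂ (Perm (Fin m)) :=
  ∑ σ : Perm (Fin m), z ^ cycleCount σ • MonoidAlgebra.of ℂ (Perm (Fin m)) σ

theorem cycleSum_commute (z : ℂ) (x : MonoidAlgebra ℂ (Perm (Fin m))) :
    Commute (cycleSum z m) x := by
  induction x using MonoidAlgebra.induction_on with
  | of τ =>
    rw [commute_iff_eq, cycleSum, Finset.sum_mul, Finset.mul_sum,
      ← Equiv.sum_comp (MulAut.conj τ).toEquiv]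
    refine Finset.sum_congr rfl fun σ _ => ?_
    change z ^ cycleCount (τ * σ * τ⁻¹) • MonoidAlgebra.of ℂ _ (τ * σ * τ⁻¹) * _ = _
    rw [cycleCount_conj, smul_mul_assoc, mul_smul_comm, ← map_mul, ← map_mul,
      inv_mul_cancel_right]
  | add x y hx hy => exact hx.add_right hy
  | smul c x hx => exact hx.smul_right c

/-- The signed sum, over the column-preserving permutations, of the indicators of the
rearrangements of the word that lists the rows of the letters of the tableau (the polytabloid of
the tableau). -/
def polytabloid (p : m.Partition) (w : Fin m → ℕ) : ℂ :=
  ∑ σ : Perm (Fin m) with ∀ k, colOf p (σ k) = colOf p k,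
    ((sign σ : ℤ) : ℂ) * if w ∘ σ = rowOf p then 1 else 0

/-- The map from functions of words to the group algebra obtained by evaluation on the
rearrangements of the row word of the tableau. -/
def toGroupAlgebra (p : m.Partition) :
    ((Fin m → ℕ) → ℂ) →ₗ[ℂ] MonoidAlgebra ℂ (Perm (Fin m)) where
  toFun v := ∑ τ : Perm (Fin m), v (rowOf p ∘ τ) • MonoidAlgebra.of ℂ (Perm (Fin m)) τ
  map_add' u v := by simp only [Pi.add_apply, add_smul, Finset.sum_add_distrib]
  map_smul' c v := by
    simp only [Pi.smul_apply, smul_eq_mul, mul_smul, Finset.smul_sum, RingHom.id_apply]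

theorem toGroupAlgebra_apply (p : m.Partition) (v : (Fin m → ℕ) → ℂ) :
    toGroupAlgebra p v =
      ∑ τ : Perm (Fin m), v (rowOf p ∘ τ) • MonoidAlgebra.of ℂ (Perm (Fin m)) τ := rfl

/-- Right multiplication appears because `cycleCount` is invariant under inversion. -/
theorem toGroupAlgebra_cycleOp (p : m.Partition) (z : ℂ) (v : (Fin m → ℕ) → ℂ) :
    toGroupAlgebra p (cycleOp z m v) = toGroupAlgebra p v * cycleSum z m := by
  simp only [toGroupAlgebra_apply, cycleOp_apply, Finset.sum_smul]
  rw [cycleSum, Finset.mul_sum, Finset.sum_comm, ← Equiv.sum_comp (Equiv.inv (Perm (Fin m)))]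
  refine Finset.sum_congr rfl fun σ _ => ?_
  rw [Finset.sum_mul, ← Equiv.sum_comp (Equiv.mulRight σ)]
  refine Finset.sum_congr rfl fun τ _ => ?_
  rw [Equiv.inv_apply, cycleCount_inv, Equiv.coe_mulRight, smul_mul_smul_comm, ← map_mul,
    mul_comm (v _)]
  congr 3
  funext k
  simp

theorem toGroupAlgebra_cycleOp_sub_pow (p : m.Partition) (z c : ℂ) (v : (Fin m → ℕ) → ℂ)
    (k : ℕ) :
    toGroupAlgebra p (((cycleOp z m - algebraMap ℂ _ c) ^ k) v) =
      toGroupAlgebra p v * (cycleSum z m - algebraMap ℂ _ c) ^ k := by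
  induction k with
  | zero => simp
  | succ k ih =>
    rw [pow_succ', Module.End.mul_apply, LinearMap.sub_apply, Module.algebraMap_end_apply,
      map_sub, map_smul, toGroupAlgebra_cycleOp, ih, pow_succ, ← mul_assoc, mul_sub,
      Algebra.algebraMap_eq_smul_one, mul_smul_comm, mul_one]

theorem toGroupAlgebra_polytabloid (p : m.Partition) :
    toGroupAlgebra p (polytabloid p) = youngSymmetrizer p := by
  simp only [toGroupAlgebra_apply, polytabloid, Finset.sum_smul]
  rw [Finset.sum_comm, youngSymmetrizer, colAntisymmetrizer, Finset.mul_sum]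
  have hinv : ∀ σ : Perm (Fin m), (∀ k, colOf p (σ k) = colOf p k) →
      ∀ k, colOf p (σ⁻¹ k) = colOf p k := fun σ h k => by
    have := h (σ⁻¹ k)
    rw [← Perm.mul_apply, mul_inv_cancel, Perm.one_apply] at this
    exact this.symm
  refine Finset.sum_bij' (fun σ _ => σ⁻¹) (fun σ _ => σ⁻¹) ?_ ?_ ?_ ?_ ?_
  · intro σ hσ
    exact Finset.mem_filter.2 ⟨Finset.mem_univ _, hinv σ (Finset.mem_filter.1 hσ).2⟩
  · intro σ hσ
    exact Finset.mem_filter.2 ⟨Finset.mem_univ _, hinv σ (Finset.mem_filter.1 hσ).2⟩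
  · intro σ _
    exact inv_inv σ
  · intro σ _
    exact inv_inv σ
  · intro σ _
    rw [sign_inv, mul_smul_comm, rowSymmetrizer, Finset.sum_mul, Finset.smul_sum,
      Finset.sum_filter, ← Equiv.sum_comp (Equiv.mulRight σ⁻¹)]
    refine Finset.sum_congr rfl fun τ _ => ?_
    rw [← map_mul]
    have hrow : (rowOf p ∘ Equiv.mulRight σ⁻¹ τ) ∘ σ = rowOf p ↔
        ∀ k, rowOf p (τ k) = rowOf p k := by
      rw [funext_iff]
      simp
    rw [if_congr hrow rfl rfl, Equiv.coe_mulRight]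
    split_ifs <;> simp

theorem isHighestWeight_polytabloid (p : m.Partition) :
    IsHighestWeight (fun i => part p (i + 1)) (polytabloid p) where
  weight w hw i := by
    obtain ⟨σ, -, hσ⟩ := Finset.exists_ne_zero_of_sum_ne_zero hw
    have hσ' : w ∘ σ = rowOf p := by
      by_contra h
      rw [if_neg h, mul_zero] at hσ
      exact hσ rfl
    rw [← card_rowOf_eq, ← hσ']
    refine (Finset.card_bij (fun k _ => σ k) ?_ ?_ ?_).symm
    · intro k hk
      simpa using hk
    · intro k _ k' _ h
      exact σ.injective h
    · intro k hk
      exact ⟨σ.symm k, by simpa using hk, by simp⟩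
  raise i j hij := by
    ext w
    let δ : (Fin m → ℕ) → ℂ := fun u => if u = rowOf p then 1 else 0
    have hδ : polytabloid p = ∑ σ : Perm (Fin m) with ∀ k, colOf p (σ k) = colOf p k,
        ((sign σ : ℤ) : ℂ) • fun u => δ (u ∘ σ) := by
      ext u
      simp [polytabloid, δ]
    rw [hδ, map_sum, Finset.sum_apply]
    simp only [map_smul, Pi.smul_apply, letterOp_comp_perm, smul_eq_mul]
    simp only [letterOp_apply, Finset.mul_sum]
    rw [Finset.sum_comm]
    refine Finset.sum_eq_zero fun k _ => ?_
    by_cases hk : rowOf p k = j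
    · -- The transposition of `k` with the letter above it in row `i` fixes every word obtained
      -- from the row word by moving `k` to row `i`, and it changes the sign.
      obtain ⟨q, hq1, hq2⟩ := exists_box_eq p (c := (i, colOf p k))
        ((diagram p).isLowerSet (Prod.mk_le_mk.2 ⟨hij.le.trans hk.ge, le_rfl⟩) (box_mem p k))
      have hqk : q ≠ k := fun h => by
        rw [h, hk] at hq1
        exact hij.ne' hq1
      have hcol : ∀ x, colOf p (swap k q x) = colOf p x := fun x => by
        rw [swap_apply_def]
        split_ifs with h1 h2
        · rw [h1]
          exact hq2
        · rw [h2]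
          exact hq2.symm
        · rfl
      have hfix : ∀ u : Fin m → ℕ, u k = i → Function.update u k j = rowOf p →
          u ∘ swap k q = u := fun u hu hu' => by
        have huq : u q = i := by
          rw [← Function.update_of_ne hqk j u, hu', hq1]
        funext x
        rw [Function.comp_apply, swap_apply_def]
        split_ifs with h1 h2
        · rw [h1, hu, huq]
        · rw [h2, hu, huq]
        · rfl
      have hinvol : ∀ σ : Perm (Fin m), σ * swap k q * swap k q = σ := fun σ => by
        rw [mul_assoc, swap_mul_self, mul_one]
      refine Finset.sum_involution (fun σ _ => σ * swap k q) ?_ ?_ ?_ ?_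
      · intro σ _
        have hsign : ((sign (σ * swap k q) : ℤ) : ℂ) = -((sign σ : ℤ) : ℂ) := by
          rw [Perm.sign_mul, sign_swap hqk.symm]
          push_cast
          ring
        have hval : (w ∘ ⇑(σ * swap k q)) = (w ∘ σ) ∘ swap k q := rfl
        have hiff : ∀ u : Fin m → ℕ, ((u ∘ swap k q) k = i ∧
            Function.update (u ∘ swap k q) k j = rowOf p) ↔
              (u k = i ∧ Function.update u k j = rowOf p) := fun u => by
          constructor
          · rintro ⟨h1, h2⟩
            have h := hfix _ h1 h2
            have h' : (u ∘ swap k q) ∘ swap k q = u := by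
              funext x
              simp
            rw [h'] at h
            rw [← h] at h1 h2
            exact ⟨h1, h2⟩
          · rintro ⟨h1, h2⟩
            rw [hfix u h1 h2]
            exact ⟨h1, h2⟩
        rw [hsign, hval]
        simp only [δ, ← ite_and]
        rw [if_congr (hiff (w ∘ σ)) rfl rfl]
        ring
      · intro σ _ _ h
        have : swap k q = 1 := by simpa using h
        exact hqk (swap_eq_one_iff.1 this).symm
      · intro σ hσ
        refine Finset.mem_filter.2 ⟨Finset.mem_univ _, fun x => ?_⟩
        rw [Perm.mul_apply, (Finset.mem_filter.1 hσ).2, hcol]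
      · intro σ _
        exact hinvol σ
    · refine Finset.sum_eq_zero fun σ _ => ?_
      split_ifs with h
      · rw [show δ _ = 0 from if_neg fun h' => hk ?_, mul_zero]
        rw [← h', Function.update_self]
      · rw [mul_zero]

theorem coeff_youngSymmetrizer_one (p : m.Partition) : (youngSymmetrizer p).coeff 1 = 1 := by
  have h : (youngSymmetrizer p).coeff 1 = polytabloid p (rowOf p) := by
    rw [← toGroupAlgebra_polytabloid, toGroupAlgebra_apply, MonoidAlgebra.coeff_sum,
      Finsupp.finsetSum_apply, Finset.sum_eq_single 1]
    · simp [MonoidAlgebra.of_apply]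
    · intro τ _ hτ
      simp [MonoidAlgebra.of_apply, hτ]
    · simp
  rw [h, polytabloid, Finset.sum_eq_single 1]
  · simp
  · intro σ hσ hne
    rw [if_neg, mul_zero]
    intro hrow
    exact hne (Perm.ext fun k => box_ext p (congrFun hrow k) ((Finset.mem_filter.1 hσ).2 k))
  · simp

theorem dimIrrep_ne_zero (p : m.Partition) : dimIrrep p ≠ 0 := by
  have hne : youngSymmetrizer p ≠ 0 := fun h => by
    have := coeff_youngSymmetrizer_one p
    rw [h] at this
    simp at this
  have : Nontrivial (irrep p) :=
    ⟨⟨youngSymmetrizer p, Ideal.subset_span rfl⟩, 0, fun h => hne (congrArg Subtype.val h)⟩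
  have : Module.Finite ℂ (irrep p) := inferInstance
  exact Module.finrank_pos.ne'

/-- `cycleSum z m` minus the content product is nilpotent on `V_λ`. -/
theorem cycleSum_sub_pow_mul (p : m.Partition) (z : ℂ) :
    ∃ k : ℕ, ∀ x ∈ irrep p, (cycleSum z m -
      algebraMap ℂ _ (contentProd (length p) (fun i => part p (i + 1)) z)) ^ k * x = 0 := by
  obtain ⟨k, hk⟩ := (isHighestWeight_polytabloid p).exists_pow_apply_eq_zero (n := length p) z
    fun i hi => part_eq_zero p hi
  have h := congrArg (toGroupAlgebra p) hk
  rw [toGroupAlgebra_cycleOp_sub_pow, toGroupAlgebra_polytabloid, map_zero] at h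
  refine ⟨k, fun x hx => ?_⟩
  obtain ⟨y, rfl⟩ := Ideal.mem_span_singleton'.1 hx
  rw [(((cycleSum_commute z _).sub_left (Algebra.commutes _ _)).pow_left k).eq, mul_assoc, h,
    mul_zero]

/-- The trace of `cycleSum z m` on `V_λ`. -/
theorem sum_mul_character (p : m.Partition) (z : ℂ) :
    ∑ σ : Perm (Fin m), z ^ cycleCount σ * (irrepRep p).character σ =
      dimIrrep p * contentProd (length p) (fun i => part p (i + 1)) z := by
  set c := contentProd (length p) (fun i => part p (i + 1)) z with hc
  obtain ⟨k, hk⟩ := cycleSum_sub_pow_mul p z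
  let T : Module.End ℂ (irrep p) := ∑ σ : Perm (Fin m), z ^ cycleCount σ • irrepRep p σ
  have hT : ∀ x : irrep p, ((T x : irrep p) : MonoidAlgebra ℂ (Perm (Fin m))) =
      cycleSum z m * x := by
    intro x
    rw [cycleSum, Finset.sum_mul, LinearMap.sum_apply, AddSubmonoidClass.coe_finsetSum]
    refine Finset.sum_congr rfl fun σ _ => ?_
    have h : irrepRep p σ x = MonoidAlgebra.of ℂ (Perm (Fin m)) σ • x := rfl
    rw [smul_mul_assoc, LinearMap.smul_apply, h]
    rfl
  have hpow : ∀ (k : ℕ) (x : irrep p), ((((T - algebraMap ℂ _ c) ^ k) x : irrep p) :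
      MonoidAlgebra ℂ (Perm (Fin m))) = (cycleSum z m - algebraMap ℂ _ c) ^ k * x := by
    intro k
    induction k with
    | zero => intro x; simp
    | succ k ih =>
      intro x
      rw [pow_succ', Module.End.mul_apply, LinearMap.sub_apply, Module.algebraMap_end_apply,
        pow_succ' (_ - _), mul_assoc, ← ih, sub_mul, ← hT, ← Algebra.smul_def]
      rfl
  have hnil : IsNilpotent (T - algebraMap ℂ _ c) :=
    ⟨k, LinearMap.ext fun x => Subtype.ext (by rw [hpow, hk x x.2]; rfl)⟩
  have htr := (LinearMap.isNilpotent_trace_of_isNilpotent hnil).eq_zero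
  have htr : LinearMap.trace ℂ (irrep p) T = c * dimIrrep p := by
    rw [← sub_add_cancel T (algebraMap ℂ _ c), LinearMap.map_add, htr,
      Algebra.algebraMap_eq_smul_one, LinearMap.map_smul, LinearMap.trace_one, zero_add]
    rfl
  rw [mul_comm, ← htr, map_sum]
  refine Finset.sum_congr rfl fun σ _ => ?_
  rw [map_smul, smul_eq_mul]
  rfl

end GroupAlgebra

/-! ### Values of the polynomial -/

theorem samuelPoly_eval {m : ℕ} (p : m.Partition) (z : ℂ) :
    (samuelPoly p).eval z = contentProd (length p) (fun i => part p (i + 1)) z := by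
  have hdim : (dimIrrep p : ℂ) ≠ 0 := Nat.cast_ne_zero.2 (dimIrrep_ne_zero p)
  rw [samuelPoly, Polynomial.eval_mul, Polynomial.eval_C, Polynomial.eval_finsetSum]
  simp only [Polynomial.eval_mul, Polynomial.eval_C, Polynomial.eval_pow, Polynomial.eval_X]
  rw [sum_classCard_mul_character, sum_mul_character]
  field_simp

theorem contentProd_eq_prod_Gamma (n : ℕ) (l : ℕ → ℕ) (z : ℂ)
    (hz : ∀ j ∈ Finset.Icc 1 n, ∀ k : ℕ, z - (j : ℂ) ≠ -((k : ℂ) + 1)) :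
    contentProd n (fun i => l (i + 1)) z = ∏ j ∈ Finset.Icc 1 n,
      Complex.Gamma (z + (l j : ℂ) - (j : ℂ) + 1) / Complex.Gamma (z - (j : ℂ) + 1) := by
  rw [contentProd, Finset.prod_bij (t := Finset.Icc 1 n) (fun i _ => i + 1)
    (g := fun j => ∏ i ∈ Finset.range (l j), (z - j + 1 + i))]
  · refine Finset.prod_congr rfl fun j hj => ?_
    rw [show z + (l j : ℂ) - j + 1 = z - j + 1 + (l j : ℂ) by ring,
      Complex.Gamma_add_nat_div_Gamma_eq]
    · induction l j with
      | zero => simp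
      | succ k ih => rw [Finset.prod_range_succ, ih, ascPochhammer_succ_eval]
    · intro k h
      exact hz j hj k (by linear_combination h)
  · intro i hi
    have := Finset.mem_range.1 hi
    exact Finset.mem_Icc.2 (by omega)
  · intro i _ i' _ h
    exact Nat.succ_injective h
  · intro j hj
    have := Finset.mem_Icc.1 hj
    exact ⟨j - 1, Finset.mem_range.2 (by omega), by omega⟩
  · intro i _
    refine Finset.prod_congr rfl fun j _ => ?_
    push_cast
    ring

end SymmetricGroupRep
end

theorem mainTheorem6 {m : ℕ} (p : m.Partition) :
    SymmetricGroupRep.samuelPoly p =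
        ∏ c ∈ (SymmetricGroupRep.diagram p).cells,
          (Polynomial.X - Polynomial.C (c.1 : ℂ) + Polynomial.C (c.2 : ℂ)) ∧
      (∀ N : ℕ, SymmetricGroupRep.length p ≤ N →
        (SymmetricGroupRep.samuelPoly p).eval (N : ℂ) =
          ∏ j ∈ Finset.Icc 1 (SymmetricGroupRep.length p),
            ((N + SymmetricGroupRep.part p j - j).factorial : ℂ) /
              ((N - j).factorial : ℂ)) ∧
      (∀ z : ℂ,
        (∀ j ∈ Finset.Icc 1 (SymmetricGroupRep.length p), ∀ n : ℕ,
          z - (j : ℂ) ≠ -((n : ℂ) + 1)) →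
        (SymmetricGroupRep.samuelPoly p).eval z =
          ∏ j ∈ Finset.Icc 1 (SymmetricGroupRep.length p),
            Complex.Gamma (z + (SymmetricGroupRep.part p j : ℂ) - (j : ℂ) + 1) /
              Complex.Gamma (z - (j : ℂ) + 1)) := by
  have hGamma : ∀ z : ℂ, (∀ j ∈ Finset.Icc 1 (SymmetricGroupRep.length p), ∀ n : ℕ,
      z - (j : ℂ) ≠ -((n : ℂ) + 1)) → (SymmetricGroupRep.samuelPoly p).eval z =
        ∏ j ∈ Finset.Icc 1 (SymmetricGroupRep.length p),
          Complex.Gamma (z + (SymmetricGroupRep.part p j : ℂ) - (j : ℂ) + 1) /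
            Complex.Gamma (z - (j : ℂ) + 1) := fun z hz => by
    rw [SymmetricGroupRep.samuelPoly_eval]
    exact SymmetricGroupRep.contentProd_eq_prod_Gamma _ (SymmetricGroupRep.part p) z hz
  refine ⟨?_, fun N hN => ?_, hGamma⟩
  · refine Polynomial.funext fun z => ?_
    rw [SymmetricGroupRep.samuelPoly_eval, Polynomial.eval_prod,
      ← SymmetricGroupRep.prod_cells_eq_contentProd]
    simp
  · rw [hGamma]
    · refine Finset.prod_congr rfl fun j hj => ?_
      have hjN : j ≤ N := (Finset.mem_Icc.1 hj).2.trans hN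
      rw [← Complex.Gamma_nat_eq_factorial, ← Complex.Gamma_nat_eq_factorial,
        Nat.cast_sub hjN, Nat.cast_sub (hjN.trans (Nat.le_add_right _ _)), Nat.cast_add]
    · intro j hj n h
      have hjN : j ≤ N := (Finset.mem_Icc.1 hj).2.trans hN
      rw [← Nat.cast_sub hjN] at h
      have h' : ((N - j + n + 1 : ℕ) : ℂ) = 0 := by
        push_cast
        linear_combination h
      exact absurd h' (Nat.cast_ne_zero.2 (Nat.succ_ne_zero _))
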